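/- A \emph{Priestley space} is a compact ordered topological space $X$ (a poset with a topology) such that whenever $x\not\le y$ there is a clopen upset $U$ with $x\in U$, $y\notin U$; $\mathbf{Pries}$ is the category of Priestley spaces and continuous monotone maps. A Priestley space is \emph{Esakia} if ${\downarrow}U$ is clopen for every clopen $U$. A \emph{p-morphism} is a continuous monotone map $p:X\to Y$ such that $p(x)\le y$ implies $p(x')=y$ for some $x'\ge x$; $\mathbf{Esa}$ is the category of Esakia spaces and p-morphisms, and $I:\mathbf{Esa}\to\mathbf{Pries}$ is the inclusion. For a Priestley space $X$ let $V(X)$ be the set of nonempty closed subsets of $X$, ordered by $C\preceq D\iff D\subseteq C$, with the topology that has the subbasis of all $[U]=\{C: C\subseteq U\}$ and $\langle U\rangle=\{C: C\cap U\ne\emptyset\}$, $U\subseteq X$ clopen. For a continuous monotone $g:X\to Y$, let $V_g(X)\subseteq V(X)$ (with the induced order and topology) consist of those $C\in V(X)$ that have a least element (the root of $C$) and are $g$-open: for all $s\in C$ and $b\in X$ with $s\le b$ there is $s'\in C$ with $s\le s'$ and $g(s')=g(b)$. Let $r_g:V_g(X)\to X$ be the map sending $C$ to its root. Put $V_0(X)=X$,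 let $r_0:X\to\{\bullet\}$ be the terminal map, $V_{n+1}(X)=V_{r_n}(V_n(X))$ and $r_{n+1}=r_{r_n}:V_{n+1}(X)\to V_n(X)$; let $V_G(X)=\varprojlim_n V_n(X)$ along the maps $r_{n+1}$, with the projection $\pi_0:V_G(X)\to X$. Then $V_G(X)$ is an Esakia space, and $V_G:\mathbf{Pries}\to\mathbf{Esa}$ is a functor, right adjoint to $I$, with counit $\pi_0$; the unit $\eta_X:X\to V_G(X)$, for $X$ Esakia, is the unique p-morphism with $\pi_0\eta_X=1_X$, and $V_G(p)$ is the unique p-morphism with $\pi_0 V_G(p)=p\,\pi_0$. Write $V_G$ also for the resulting comonad $I V_G$ on $\mathbf{Pries}$, with counit $\pi_0$ and comultiplication $\eta_{V_G(X)}$. A \emph{$V_G$-coalgebra structure} on $X$ is a continuous monotone $f:X\to V_G(X)$ with $\pi_0 f=1_X$ and $\eta_{V_G(X)}\circ f=V_G(f)\circ f$. \textbf{Theorem.} \begin{enumerate} \item For every Priestley space $X$ the following are equivalent: (a) $X$ is Esakia; (b) $X$ admits a $V_G$-coalgebra structure; (b$'$) $X$ admits exactly one $V_G$-coalgebra structure;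 (c) the map $X\to V(X)$, $x\mapsto{\uparrow}x$, is monotone and continuous; (d) the map $V(X)\to V(X)$, $C\mapsto{\uparrow}C$, is monotone and continuous. \item If $f$ and $g$ are $V_G$-coalgebra structures on Priestley spaces $X$ and $Y$, then a continuous monotone map $p:X\to Y$ is a coalgebra morphism, i.e. $V_G(p)\circ f=g\circ p$, if and only if $p$ is a p-morphism. \item The adjunction $I\dashv V_G$ is comonadic: the comparison functor from $\mathbf{Esa}$ to the category of Eilenberg--Moore coalgebras of the comonad $V_G$ on $\mathbf{Pries}$ is an equivalence. \item Dually, the category $\mathbf{HA}$ of Heyting algebras is monadic over the category $\mathbf{DLat}$ of bounded distributive lattices (equivalently, $\mathbf{HA}^{\mathrm{op}}$ is comonadic over $\mathbf{DLat}^{\mathrm{op}}$): the forgetful functor $\mathbf{HA}\to\mathbf{DLat}$ has a left adjoint, and the comparison functor from $\mathbf{HA}$ to the category of algebras of the induced monad is an equivalence. \end{enumerate} -/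

import Mathlib

open CategoryTheory Topology Set

universe u

namespace PriestleyDuality

/-! ### Compact Priestley spaces -/

section Basic

variable {X Y : Type*} [TopologicalSpace X] [PartialOrder X] [CompactSpace X] [PriestleySpace X]

theorem exists_upper_of_disjoint {K : Set X} (hK : IsClosed K) {s : X} (h : ∀ k ∈ K, ¬ s ≤ k) :
    ∃ U : Set X, IsClopen U ∧ IsUpperSet U ∧ s ∈ U ∧ Disjoint U K := by
  refine hK.isCompact.induction_on
    (p := fun K => ∃ U : Set X, IsClopen U ∧ IsUpperSet U ∧ s ∈ U ∧ Disjoint U K) ?_ ?_ ?_ ?_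
  · exact ⟨univ, isClopen_univ, isUpperSet_univ, mem_univ _, disjoint_empty _⟩
  · rintro A B hAB ⟨U, h1, h2, h3, h4⟩
    exact ⟨U, h1, h2, h3, h4.mono_right hAB⟩
  · rintro A B ⟨U, h1, h2, h3, h4⟩ ⟨V, k1, k2, k3, k4⟩
    exact ⟨U ∩ V, h1.inter k1, h2.inter k2, ⟨h3, k3⟩,
      disjoint_union_right.2 ⟨h4.mono_left inter_subset_left, k4.mono_left inter_subset_right⟩⟩
  · intro x hx
    obtain ⟨U, h1, h2, h3, h4⟩ := exists_isClopen_upper_of_not_le (h x hx)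
    exact ⟨Uᶜ, mem_nhdsWithin_of_mem_nhds (h1.compl.isOpen.mem_nhds h4), U, h1, h2, h3,
      disjoint_compl_right⟩

theorem exists_lower_of_disjoint {K : Set X} (hK : IsClosed K) {s : X} (h : ∀ k ∈ K, ¬ k ≤ s) :
    ∃ U : Set X, IsClopen U ∧ IsLowerSet U ∧ s ∈ U ∧ Disjoint U K := by
  refine hK.isCompact.induction_on
    (p := fun K => ∃ U : Set X, IsClopen U ∧ IsLowerSet U ∧ s ∈ U ∧ Disjoint U K) ?_ ?_ ?_ ?_
  · exact ⟨univ, isClopen_univ, isLowerSet_univ, mem_univ _, disjoint_empty _⟩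
  · rintro A B hAB ⟨U, h1, h2, h3, h4⟩
    exact ⟨U, h1, h2, h3, h4.mono_right hAB⟩
  · rintro A B ⟨U, h1, h2, h3, h4⟩ ⟨V, k1, k2, k3, k4⟩
    exact ⟨U ∩ V, h1.inter k1, h2.inter k2, ⟨h3, k3⟩,
      disjoint_union_right.2 ⟨h4.mono_left inter_subset_left, k4.mono_left inter_subset_right⟩⟩
  · intro x hx
    obtain ⟨U, h1, h2, h3, h4⟩ := exists_isClopen_lower_of_not_le (h x hx)
    exact ⟨Uᶜ, mem_nhdsWithin_of_mem_nhds (h1.compl.isOpen.mem_nhds h3), U, h1, h2, h4,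
      disjoint_compl_right⟩

theorem isClosed_lowerClosure {K : Set X} (hK : IsClosed K) :
    IsClosed (lowerClosure K : Set X) := by
  rw [← isOpen_compl_iff, isOpen_iff_forall_mem_open]
  intro s hs
  have hs' : ∀ k ∈ K, ¬ s ≤ k := fun k hk h => hs ⟨k, hk, h⟩
  obtain ⟨U, h1, h2, h3, h4⟩ := exists_upper_of_disjoint hK hs'
  refine ⟨U, ?_, h1.isOpen, h3⟩
  rintro x hx ⟨k, hk, hxk⟩
  exact disjoint_left.1 h4 (h2 hxk hx) hk

theorem isClosed_upperClosure {K : Set X} (hK : IsClosed K) :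
    IsClosed (upperClosure K : Set X) := by
  rw [← isOpen_compl_iff, isOpen_iff_forall_mem_open]
  intro s hs
  have hs' : ∀ k ∈ K, ¬ k ≤ s := fun k hk h => hs ⟨k, hk, h⟩
  obtain ⟨U, h1, h2, h3, h4⟩ := exists_lower_of_disjoint hK hs'
  refine ⟨U, ?_, h1.isOpen, h3⟩
  rintro x hx ⟨k, hk, hxk⟩
  exact disjoint_left.1 h4 (h2 hxk hx) hk

theorem isClosed_principalUp (x : X) : IsClosed (Ici x) := by
  have := isClosed_upperClosure (isClosed_singleton (x := x))
  rwa [upperClosure_singleton, UpperSet.coe_Ici] at this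

theorem continuous_of_clopenUpper [TopologicalSpace Y] {f : Y → X}
    (h : ∀ U : Set X, IsClopen U → IsUpperSet U → IsClopen (f ⁻¹' U)) : Continuous f := by
  rw [continuous_iff_ultrafilter]
  intro x F hF
  obtain ⟨y, hy⟩ : ∃ y, (F.map f : Filter X) ≤ 𝓝 y := by
    obtain ⟨y, -, hy⟩ := isCompact_iff_ultrafilter_le_nhds.1 (isCompact_univ (X := X)) (F.map f)
      (by simp)
    exact ⟨y, hy⟩
  have key : ∀ U : Set X, IsClopen U → IsUpperSet U → (f x ∈ U ↔ y ∈ U) := by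
    intro U hU hU'
    constructor
    · intro hx
      by_contra hyU
      have h1 : f ⁻¹' U ∈ F := hF ((h U hU hU').isOpen.mem_nhds hx)
      have h2 : f ⁻¹' Uᶜ ∈ F := hy (hU.compl.isOpen.mem_nhds hyU)
      exact F.compl_notMem_iff.2 h1 h2
    · intro hyU
      by_contra hx
      have h1 : f ⁻¹' U ∈ F := hy (hU.isOpen.mem_nhds hyU)
      have h2 : (f ⁻¹' U)ᶜ ∈ F := hF ((h U hU hU').compl.isOpen.mem_nhds hx)
      exact F.compl_notMem_iff.2 h1 h2
  have hxy : f x = y := by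
    apply le_antisymm
    · by_contra hn
      obtain ⟨U, h1, h2, h3, h4⟩ := exists_isClopen_upper_of_not_le hn
      exact h4 ((key U h1 h2).1 h3)
    · by_contra hn
      obtain ⟨U, h1, h2, h3, h4⟩ := exists_isClopen_upper_of_not_le hn
      exact h4 ((key U h1 h2).2 h3)
  rw [hxy]
  exact hy

end Basic

/-- An ordered topological space satisfies the Esakia condition if downsets of clopens are clopen.
A (compact) Priestley space with this property is an Esakia space. -/
def IsEsakia (X : Type*) [TopologicalSpace X] [PartialOrder X] : Prop :=
  ∀ U : Set X, IsClopen U → IsClopen (lowerClosure U : Set X)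

/-- The p-morphism (back) condition. -/
def IsPMorphism {X Y : Type*} [PartialOrder X] [PartialOrder Y] (f : X → Y) : Prop :=
  ∀ ⦃x : X⦄ ⦃y : Y⦄, f x ≤ y → ∃ x', x ≤ x' ∧ f x' = y

/-! ### The Vietoris hyperspace -/

/-- The nonempty closed subsets of `X`. -/
def Vietoris (X : Type*) [TopologicalSpace X] : Type _ :=
  {C : Set X // IsClosed C ∧ C.Nonempty}

namespace Vietoris

variable {X : Type*} [TopologicalSpace X]

/-- The elements `C` of `V(X)` with `C ⊆ U`. -/
def box (U : Set X) : Set (Vietoris X) := {C | C.1 ⊆ U}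

/-- The elements `C` of `V(X)` that meet `U`. -/
def dia (U : Set X) : Set (Vietoris X) := {C | (C.1 ∩ U).Nonempty}

/-- The hit-and-miss topology, with subbasis `[U]`, `⟨U⟩` for `U` clopen. -/
instance : TopologicalSpace (Vietoris X) :=
  TopologicalSpace.generateFrom {A | ∃ U : Set X, IsClopen U ∧ (A = box U ∨ A = dia U)}

/-- Reverse inclusion. -/
instance : PartialOrder (Vietoris X) where
  le C D := D.1 ⊆ C.1
  le_refl _ := Subset.rfl
  le_trans _ _ _ h k := k.trans h
  le_antisymm _ _ h k := Subtype.ext (k.antisymm h)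

theorem le_def {C D : Vietoris X} : C ≤ D ↔ D.1 ⊆ C.1 := Iff.rfl

theorem compl_box (U : Set X) : (box U)ᶜ = dia Uᶜ := by
  ext C
  simp only [box, dia, mem_compl_iff, mem_ofPred_eq, not_subset]
  rfl

theorem compl_dia (U : Set X) : (dia U)ᶜ = box Uᶜ := by
  rw [← compl_compl (box Uᶜ), compl_box, compl_compl]

theorem isOpen_box {U : Set X} (hU : IsClopen U) : IsOpen (box U) :=
  TopologicalSpace.isOpen_generateFrom_of_mem ⟨U, hU, Or.inl rfl⟩

theorem isOpen_dia {U : Set X} (hU : IsClopen U) : IsOpen (dia U) :=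
  TopologicalSpace.isOpen_generateFrom_of_mem ⟨U, hU, Or.inr rfl⟩

theorem isClopen_box {U : Set X} (hU : IsClopen U) : IsClopen (box U) :=
  ⟨by rw [← isOpen_compl_iff, compl_box]; exact isOpen_dia hU.compl, isOpen_box hU⟩

theorem isClopen_dia {U : Set X} (hU : IsClopen U) : IsClopen (dia U) :=
  ⟨by rw [← isOpen_compl_iff, compl_dia]; exact isOpen_box hU.compl, isOpen_dia hU⟩

instance [CompactSpace X] : CompactSpace (Vietoris X) := by
  refine compactSpace_generateFrom rfl fun P hP hcov => ?_
  let O : Set X := ⋃₀ {U | IsClopen U ∧ dia U ∈ P}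
  have hO : IsOpen O := isOpen_sUnion fun U hU => hU.1.isOpen
  -- finitely many `⟨V⟩` in the cover suffice for closed sets meeting `K ⊆ O`
  have main : ∀ K : Set X, IsClosed K → K ⊆ O →
      ∃ Q ⊆ P, Q.Finite ∧ ∀ C : Vietoris X, (C.1 ∩ K).Nonempty → C ∈ ⋃₀ Q := by
    intro K hK hKO
    refine hK.isCompact.induction_on
      (p := fun K => ∃ Q ⊆ P, Q.Finite ∧ ∀ C : Vietoris X, (C.1 ∩ K).Nonempty → C ∈ ⋃₀ Q)
      ?_ ?_ ?_ ?_
    · exact ⟨∅, empty_subset _, finite_empty, fun C hC => by simp at hC⟩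
    · rintro A B hAB ⟨Q, h1, h2, h3⟩
      exact ⟨Q, h1, h2, fun C hC => h3 C (hC.mono (inter_subset_inter_right _ hAB))⟩
    · rintro A B ⟨Q, h1, h2, h3⟩ ⟨R, k1, k2, k3⟩
      refine ⟨Q ∪ R, union_subset h1 k1, h2.union k2, fun C hC => ?_⟩
      rw [sUnion_union]
      rw [inter_union_distrib_left, union_nonempty] at hC
      exact hC.imp (h3 C) (k3 C)
    · intro x hx
      obtain ⟨U, ⟨hU, hUP⟩, hxU⟩ := hKO hx
      exact ⟨U, mem_nhdsWithin_of_mem_nhds (hU.isOpen.mem_nhds hxU), {dia U},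
        by simpa using hUP, finite_singleton _, fun C hC => ⟨_, rfl, hC⟩⟩
  by_cases hE : Oᶜ.Nonempty
  · have hC : (⟨Oᶜ, hO.isClosed_compl, hE⟩ : Vietoris X) ∈ ⋃₀ P := by rw [hcov]; trivial
    obtain ⟨A, hA, hCA⟩ := hC
    obtain ⟨U, hU, rfl | rfl⟩ := hP hA
    · obtain ⟨Q, h1, h2, h3⟩ := main Uᶜ hU.compl.isClosed (compl_subset_comm.1 hCA)
      refine ⟨insert (box U) Q, insert_subset hA h1, h2.insert _, eq_univ_of_forall fun D => ?_⟩
      rw [sUnion_insert]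
      by_cases hD : D.1 ⊆ U
      · exact Or.inl hD
      · exact Or.inr (h3 D (by
          obtain ⟨x, hx, hxU⟩ := not_subset.1 hD
          exact ⟨x, hx, hxU⟩))
    · obtain ⟨x, hx, hxU⟩ := hCA
      exact absurd ⟨U, ⟨hU, hA⟩, hxU⟩ hx
  · obtain ⟨Q, h1, h2, h3⟩ := main univ isClosed_univ (fun x _ => by
      by_contra hx
      exact hE ⟨x, hx⟩)
    exact ⟨Q, h1, h2, eq_univ_of_forall fun D => h3 D (by simpa using D.2.2)⟩

instance [PartialOrder X] [CompactSpace X] [PriestleySpace X] : PriestleySpace (Vietoris X) where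
  priestley := by
    intro C D h
    obtain ⟨d, hd, hdC⟩ := not_subset.1 h
    obtain ⟨U, hU, hCU, hUd⟩ := exists_clopen_of_closed_subset_open C.2.1
      (isOpen_compl_singleton (x := d)) (fun x hx hxd => hdC (hxd ▸ hx))
    exact ⟨box U, isClopen_box hU, fun A B hAB hA => Subset.trans (le_def.1 hAB) hA, hCU,
      fun hDU => hUd (hDU hd) rfl⟩

end Vietoris

section UpMaps

variable {X : Type*} [TopologicalSpace X] [PartialOrder X] [CompactSpace X] [PriestleySpace X]

/-- The map `↑ : X → V(X)`. -/
def upPoint (x : X) : Vietoris X := ⟨Ici x, isClosed_principalUp x, nonempty_Ici⟩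

/-- The map `↑ : V(X) → V(X)`. -/
def upSet (C : Vietoris X) : Vietoris X :=
  ⟨upperClosure C.1, isClosed_upperClosure C.2.1, C.2.2.mono subset_upperClosure⟩

end UpMaps

/-! ### Rooted, `g`-open closed subsets -/

section Vg

variable {X Y : Type*} [TopologicalSpace X] [PartialOrder X]

/-- `S` is `g`-open. -/
def IsGOpen (g : X → Y) (S : Set X) : Prop :=
  ∀ s ∈ S, ∀ b, s ≤ b → ∃ s' ∈ S, s ≤ s' ∧ g s' = g b

/-- The space `V_g(X)` of closed, rooted and `g`-open subsets of `X`, with the topology and the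
order induced from `V(X)`. -/
def Vg (g : X → Y) : Type _ :=
  {C : Vietoris X // (∃ r, IsLeast C.1 r) ∧ IsGOpen g C.1}

instance (g : X → Y) : TopologicalSpace (Vg g) := instTopologicalSpaceSubtype
instance (g : X → Y) : PartialOrder (Vg g) := Subtype.partialOrder _

namespace Vg

variable {g : X → Y}

/-- The underlying subset of `X`. -/
def set (M : Vg g) : Set X := M.1.1

theorem le_def {M N : Vg g} : M ≤ N ↔ N.set ⊆ M.set := Iff.rfl

theorem ext_set {M N : Vg g} (h : M.set = N.set) : M = N := Subtype.ext (Subtype.ext h)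

/-- The root map `r_g : V_g(X) → X`. -/
noncomputable def root (M : Vg g) : X := M.2.1.choose

theorem root_spec (M : Vg g) : IsLeast M.set M.root := M.2.1.choose_spec

theorem root_mem (M : Vg g) : M.root ∈ M.set := M.root_spec.1

theorem root_le {M : Vg g} {x : X} (h : x ∈ M.set) : M.root ≤ x := M.root_spec.2 h

theorem root_eq {M : Vg g} {x : X} (h : IsLeast M.set x) : M.root = x := M.root_spec.unique h

theorem root_mono : Monotone (root : Vg g → X) := fun _ N h => root_le (h N.root_mem)

theorem root_preimage {U : Set X} (hU : IsUpperSet U) :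
    (root : Vg g → X) ⁻¹' U = Subtype.val ⁻¹' Vietoris.box U := by
  ext M
  exact ⟨fun h x hx => hU (root_le hx) h, fun h => h M.root_mem⟩

variable [CompactSpace X] [PriestleySpace X]

theorem root_continuous : Continuous (root : Vg g → X) :=
  continuous_of_clopenUpper fun U hU hU' => by
    rw [root_preimage hU']
    exact (Vietoris.isClopen_box hU).preimage continuous_subtype_val

/-- `M ∩ ↑w` for `w ∈ M`. -/
def restrict (M : Vg g) (w : X) (hw : w ∈ M.set) : Vg g :=
  ⟨⟨M.set ∩ Ici w, M.1.2.1.inter (isClosed_principalUp w), w, hw, le_rfl⟩,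
    ⟨w, ⟨hw, le_rfl⟩, fun _ h => h.2⟩, fun s hs b hb => by
      obtain ⟨s', h1, h2, h3⟩ := M.2.2 s hs.1 b hb
      exact ⟨s', ⟨h1, le_trans (mem_Ici.1 hs.2) h2⟩, h2, h3⟩⟩

theorem le_restrict (M : Vg g) (w : X) (hw : w ∈ M.set) : M ≤ M.restrict w hw :=
  fun _ h => h.1

theorem root_restrict (M : Vg g) (w : X) (hw : w ∈ M.set) : (M.restrict w hw).root = w :=
  root_eq ⟨⟨hw, le_rfl⟩, fun _ h => h.2⟩

/-- Downsets of preimages of clopens under the root map are clopen. -/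
theorem isClopen_lower_root (W : Set X) (hW : IsClopen W) :
    IsClopen (lowerClosure ((root : Vg g → X) ⁻¹' W) : Set (Vg g)) := by
  have : (lowerClosure ((root : Vg g → X) ⁻¹' W) : Set (Vg g)) =
      Subtype.val ⁻¹' Vietoris.dia W := by
    ext M
    constructor
    · rintro ⟨N, hN, hMN⟩
      exact ⟨N.root, hMN N.root_mem, hN⟩
    · rintro ⟨w, hw, hwW⟩
      refine ⟨M.restrict w hw, ?_, M.le_restrict w hw⟩
      change (M.restrict w hw).root ∈ W
      exact mem_of_eq_of_mem (root_restrict M w hw) hwW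
  rw [this]
  exact (Vietoris.isClopen_dia hW).preimage continuous_subtype_val

instance : PriestleySpace (Vg g) where
  priestley := by
    intro M N h
    obtain ⟨U, h1, h2, h3, h4⟩ := exists_isClopen_upper_of_not_le (x := M.1) (y := N.1) h
    exact ⟨Subtype.val ⁻¹' U, h1.preimage continuous_subtype_val, fun A B hAB hA => h2 hAB hA,
      h3, h4⟩

theorem isClosed_rooted : IsClosed {C : Vietoris X | ∃ r, IsLeast C.1 r} := by
  rw [← isOpen_compl_iff, isOpen_iff_forall_mem_open]
  intro C hC
  -- every piece of `C` is covered by clopen upsets not containing `C`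
  obtain ⟨A, h1, h2, h3, h4⟩ : ∃ (A : Set (Vietoris X)), IsOpen A ∧ C ∈ A ∧
      ∃ _ : True, ∀ N ∈ A, ∀ r ∈ N.1, ¬ IsLeast N.1 r := by
    obtain ⟨A, O, h1, h2, h3, h4, h5⟩ : ∃ (A : Set (Vietoris X)) (O : Set X), IsOpen A ∧ C ∈ A ∧
        IsClopen O ∧ C.1 ⊆ O ∧ ∀ N ∈ A, ∀ r ∈ O, ¬ IsLeast N.1 r := by
      refine C.2.1.isCompact.induction_on (p := fun K => ∃ (A : Set (Vietoris X)) (O : Set X),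
        IsOpen A ∧ C ∈ A ∧ IsClopen O ∧ K ⊆ O ∧ ∀ N ∈ A, ∀ r ∈ O, ¬ IsLeast N.1 r) ?_ ?_ ?_ ?_
      · exact ⟨univ, ∅, isOpen_univ, trivial, isClopen_empty, Subset.rfl,
          fun _ _ r hr => hr.elim⟩
      · rintro S T hST ⟨A, O, h1, h2, h3, h4, h5⟩
        exact ⟨A, O, h1, h2, h3, hST.trans h4, h5⟩
      · rintro S T ⟨A, O, h1, h2, h3, h4, h5⟩ ⟨B, P, k1, k2, k3, k4, k5⟩
        exact ⟨A ∩ B, O ∪ P, h1.inter k1, ⟨h2, k2⟩, h3.union k3, union_subset_union h4 k4,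
          fun N hN r hr => hr.elim (h5 N hN.1 r) (k5 N hN.2 r)⟩
      · intro x hx
        have : ∃ y ∈ C.1, ¬ x ≤ y := by
          by_contra hn
          push Not at hn
          exact hC ⟨x, hx, fun y hy => hn y hy⟩
        obtain ⟨y, hy, hxy⟩ := this
        obtain ⟨U, k1, k2, k3, k4⟩ := exists_isClopen_upper_of_not_le hxy
        refine ⟨U, mem_nhdsWithin_of_mem_nhds (k1.isOpen.mem_nhds k3), Vietoris.dia Uᶜ, U,
          Vietoris.isOpen_dia k1.compl, ⟨y, hy, k4⟩, k1, Subset.rfl, ?_⟩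
        rintro N ⟨z, hz, hzU⟩ r hr hl
        exact hzU (k2 (hl.2 hz) hr)
    refine ⟨A ∩ Vietoris.box O, h1.inter (Vietoris.isOpen_box h3), ⟨h2, h4⟩, trivial,
      fun N hN r hr => h5 N hN.1 r (hN.2 hr)⟩
  exact ⟨A, fun N hN ⟨r, hr⟩ => h4 N hN r hr.1 hr, h1, h2⟩

theorem isClosed_gOpen [TopologicalSpace Y] [CompactSpace Y] [PartialOrder Y] [PriestleySpace Y]
    (hg : Continuous g)
    (hc : ∀ W : Set Y, IsClopen W → IsClopen (lowerClosure (g ⁻¹' W) : Set X)) :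
    IsClosed {C : Vietoris X | IsGOpen g C.1} := by
  rw [← isOpen_compl_iff, isOpen_iff_forall_mem_open]
  intro M hM
  have hM' : ¬ IsGOpen g M.1 := hM
  unfold IsGOpen at hM'
  push Not at hM'
  obtain ⟨s, hs, b, hsb, hne⟩ := hM'
  have hK : IsClosed (g '' (M.1 ∩ Ici s)) :=
    ((M.2.1.inter (isClosed_principalUp s)).isCompact.image hg).isClosed
  obtain ⟨W', hW', hKW, hWb⟩ := exists_clopen_of_closed_subset_open hK
    (isOpen_compl_singleton (x := g b)) (by
      rintro _ ⟨x, hx, rfl⟩ h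
      exact hne x hx.1 hx.2 h)
  have hA : IsClopen (g ⁻¹' W'ᶜ) := hW'.compl.preimage hg
  obtain ⟨U, h1, h2, h3, h4⟩ := exists_upper_of_disjoint (K := M.1 ∩ g ⁻¹' W'ᶜ)
    (M.2.1.inter hA.isClosed) (s := s) (fun k hk hsk => hk.2 (hKW ⟨k, ⟨hk.1, hsk⟩, rfl⟩))
  refine ⟨Vietoris.box (U ∩ g ⁻¹' W'ᶜ)ᶜ ∩
    Vietoris.dia (U ∩ (lowerClosure (g ⁻¹' W'ᶜ) : Set X)), ?_,
    (Vietoris.isOpen_box (h1.inter hA).compl).inter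
      (Vietoris.isOpen_dia (h1.inter (hc _ hW'.compl))), ?_, ?_⟩
  · rintro N ⟨hN1, t, htN, htU, b', hb', htb'⟩ hN
    obtain ⟨t', ht', htt', he⟩ := hN t htN b' htb'
    refine hN1 ht' ⟨h2 htt' htU, ?_⟩
    rw [mem_preimage, he]
    exact hb'
  · exact fun x hx hxU => disjoint_left.1 h4 hxU.1 ⟨hx, hxU.2⟩
  · exact ⟨s, hs, h3, b, fun hb => hWb hb rfl, hsb⟩

theorem compactSpace [TopologicalSpace Y] [CompactSpace Y] [PartialOrder Y] [PriestleySpace Y]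
    (hg : Continuous g)
    (hc : ∀ W : Set Y, IsClopen W → IsClopen (lowerClosure (g ⁻¹' W) : Set X)) :
    CompactSpace (Vg g) :=
  isCompact_iff_compactSpace.1
    (isClosed_rooted.inter (isClosed_gOpen hg hc) :
      IsClosed {C : Vietoris X | (∃ r, IsLeast C.1 r) ∧ IsGOpen g C.1}).isCompact

end Vg
end Vg

/-! ### The categories of Priestley and Esakia spaces -/

/-- Priestley spaces. -/
structure Pries where
  /-- The underlying type. -/
  carrier : Type u
  [top : TopologicalSpace carrier]
  [ord : PartialOrder carrier]
  [compact : CompactSpace carrier]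
  [priestley : PriestleySpace carrier]

namespace Pries

instance : CoeSort Pries.{u} (Type u) := ⟨carrier⟩

attribute [instance] top ord compact priestley

/-- Morphisms of Priestley spaces are the continuous monotone maps. -/
instance : Category Pries.{u} where
  Hom X Y := ContinuousOrderHom X Y
  id X := ContinuousOrderHom.id X
  comp f g := ContinuousOrderHom.comp g f

instance : ConcreteCategory Pries.{u} (fun X Y => ContinuousOrderHom X Y) where
  hom f := f
  ofHom f := f

end Pries

/-- Esakia spaces. -/
structure Esa where
  /-- The underlying Priestley space. -/
  toPries : Pries.{u}
  esakia : IsEsakia toPries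

namespace Esa

/-- Morphisms of Esakia spaces are the continuous (monotone) p-morphisms. -/
instance : Category Esa.{u} where
  Hom X Y := EsakiaHom X.toPries Y.toPries
  id X := EsakiaHom.id X.toPries
  comp f g := EsakiaHom.comp g f

/-- The inclusion of Esakia spaces into Priestley spaces. -/
def incl : Esa.{u} ⥤ Pries.{u} where
  obj X := X.toPries
  map f := EsakiaHom.toContinuousOrderHom f

end Esa

/-! ### The Vietoris complex -/

/-- A Priestley map `g : X → Y` for which the downsets of preimages of clopens are clopen, i.e.
the relative pseudocomplements `g⁻¹[U] → g⁻¹[V]` exist. -/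
structure Stage where
  X : Pries.{u}
  Y : Pries.{u}
  g : ContinuousOrderHom X Y
  isClopen_lower : ∀ W : Set Y, IsClopen W → IsClopen (lowerClosure (g ⁻¹' W) : Set X)

namespace Stage

/-- `V_g(X)` as a Priestley space. -/
def VgPries (S : Stage.{u}) : Pries.{u} :=
  haveI := Vg.compactSpace S.g.continuous_toFun S.isClopen_lower
  { carrier := Vg S.g }

/-- The root map `V_g(X) → X`. -/
noncomputable def rootMap (S : Stage.{u}) : ContinuousOrderHom S.VgPries S.X where
  toFun := fun M : Vg S.g => M.root
  monotone' := Vg.root_mono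
  continuous_toFun := Vg.root_continuous

/-- From `g : X → Y` to the root map `r_g : V_g(X) → X`. -/
noncomputable def next (S : Stage.{u}) : Stage.{u} where
  X := S.VgPries
  Y := S.X
  g := S.rootMap
  isClopen_lower := Vg.isClopen_lower_root (g := S.g)

/-- The terminal map from a Priestley space to the point. -/
def terminal (X : Pries.{u}) : Stage.{u} where
  X := X
  Y := { carrier := PUnit.{u + 1}
         priestley := ⟨fun h => (h trivial).elim⟩ }
  g := ⟨⟨fun _ => PUnit.unit, fun _ _ _ => le_rfl⟩, continuous_const⟩
  isClopen_lower := by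
    intro W _
    by_cases h : PUnit.unit ∈ W
    · have : (lowerClosure ((fun _ : X => PUnit.unit) ⁻¹' W) : Set X) = univ :=
        eq_univ_of_forall fun x => ⟨x, h, le_rfl⟩
      exact this ▸ isClopen_univ
    · have : (lowerClosure ((fun _ : X => PUnit.unit) ⁻¹' W) : Set X) = ∅ :=
        eq_empty_of_forall_notMem fun x ⟨_, hy, _⟩ => h hy
      exact this ▸ isClopen_empty

end Stage

/-- The Vietoris complex of `X → {•}`: its `n`-th entry has source `V_n(X)`, and its map is
`r_n : V_n(X) → V_{n-1}(X)` (for `n = 0` the terminal map `X → {•}`). -/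
noncomputable def stage (X : Pries.{u}) : ℕ → Stage.{u}
  | 0 => Stage.terminal X
  | n + 1 => (stage X n).next

/-- The Priestley space `V_n(X)`. -/
noncomputable def level (X : Pries.{u}) (n : ℕ) : Pries.{u} := (stage X n).X

/-- The connecting (root) map `V_{n+1}(X) → V_n(X)`. -/
noncomputable def conn (X : Pries.{u}) (n : ℕ) :
    ContinuousOrderHom (level X (n + 1)) (level X n) := (stage X n).rootMap

/-- An element of `V_{n+1}(X)` as a subset of `V_n(X)`. -/
def levelSet {X : Pries.{u}} {n : ℕ} (M : level X (n + 1)) : Set (level X n) :=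
  Vg.set (g := (stage X n).g) M

/-- The projective limit of the Vietoris complex. -/
def Limit (X : Pries.{u}) : Type u :=
  {z : ∀ n, level X n // ∀ n, conn X n (z (n + 1)) = z n}

namespace Limit

variable {X : Pries.{u}}

noncomputable instance : TopologicalSpace (Limit X) := instTopologicalSpaceSubtype
noncomputable instance : PartialOrder (Limit X) := Subtype.partialOrder _

/-- The `n`-th projection. -/
def proj (n : ℕ) (z : Limit X) : level X n := z.1 n

theorem proj_continuous (n : ℕ) : Continuous (proj (X := X) n) :=
  (continuous_apply n).comp continuous_subtype_val

theorem conn_proj (z : Limit X) (n : ℕ) : conn X n (proj (n + 1) z) = proj n z := z.2 n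

theorem le_iff {z w : Limit X} : z ≤ w ↔ ∀ n, proj n z ≤ proj n w := Iff.rfl

theorem ext_proj {z w : Limit X} (h : ∀ n, proj n z = proj n w) : z = w :=
  Subtype.ext (funext h)

instance : CompactSpace (Limit X) :=
  isCompact_iff_compactSpace.1 (IsClosed.isCompact (s := {z : ∀ n, level X n |
      ∀ n, conn X n (z (n + 1)) = z n}) <| by
    have : {z : ∀ n, level X n | ∀ n, conn X n (z (n + 1)) = z n} =
        ⋂ n, {z | conn X n (z (n + 1)) = z n} := by ext; simp
    rw [this]
    exact isClosed_iInter fun n => isClosed_eq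
      ((conn X n).continuous_toFun.comp (continuous_apply _)) (continuous_apply _))

instance : PriestleySpace (Limit X) where
  priestley := by
    intro z w h
    rw [le_iff, not_forall] at h
    obtain ⟨n, hn⟩ := h
    obtain ⟨U, h1, h2, h3, h4⟩ := exists_isClopen_upper_of_not_le hn
    exact ⟨proj n ⁻¹' U, h1.preimage (proj_continuous n), fun A B hAB hA => h2 (hAB n) hA, h3, h4⟩

theorem mem_nhds {z : Limit X} {A : Set (Limit X)} (hA : A ∈ 𝓝 z) :
    ∃ n, ∃ W : Set (level X n), IsOpen W ∧ proj n z ∈ W ∧ proj n ⁻¹' W ⊆ A := by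
  have hn : 𝓝 z = ⨅ n, Filter.comap (proj n) (𝓝 (proj n z)) := by
    have h1 : 𝓝 z = Filter.comap Subtype.val (𝓝 z.1) := nhds_induced _ _
    rw [h1, nhds_pi, Filter.pi, Filter.comap_iInf]
    simp only [Filter.comap_comap]
    rfl
  rw [hn, Filter.mem_iInf_of_directed] at hA
  · obtain ⟨n, hA⟩ := hA
    obtain ⟨T, hT, hTA⟩ := Filter.mem_comap.1 hA
    obtain ⟨W, hWT, hW, hzW⟩ := _root_.mem_nhds_iff.1 hT
    exact ⟨n, W, hW, hzW, (preimage_mono hWT).trans hTA⟩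
  · apply Antitone.directed_ge
    refine antitone_nat_of_succ_le fun n => ?_
    have h1 : (proj (X := X) n) = conn X n ∘ proj (n + 1) := funext fun w => (conn_proj w n).symm
    have h2 : 𝓝 (proj (n + 1) z) ≤ Filter.comap (conn X n) (𝓝 (proj n z)) := by
      rw [← Filter.tendsto_iff_comap, ← conn_proj z n]
      exact (conn X n).continuous_toFun.tendsto _
    calc Filter.comap (proj (n + 1)) (𝓝 (proj (n + 1) z))
        ≤ Filter.comap (proj (n + 1)) (Filter.comap (conn X n) (𝓝 (proj n z))) :=
          Filter.comap_mono h2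
      _ = Filter.comap (proj n) (𝓝 (proj n z)) := by
          rw [Filter.comap_comap, ← h1]

/-- In an inverse sequence of surjections every element of some level lies on a thread. -/
theorem exists_thread (m : ℕ) : ∀ (T : ℕ → Type u) (ρ : ∀ n, T (n + 1) → T n)
    (_ : ∀ n, Function.Surjective (ρ n)) (s : T m),
    ∃ t : ∀ n, T n, (∀ n, ρ n (t (n + 1)) = t n) ∧ t m = s := by
  induction m with
  | zero =>
    intro T ρ hρ s
    refine ⟨fun n => Nat.rec s (fun n t => (hρ n t).choose) n, fun n => ?_, rfl⟩
    exact (hρ n _).choose_spec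
  | succ m ih =>
    intro T ρ hρ s
    obtain ⟨t, ht, hs⟩ := ih (fun n => T (n + 1)) (fun n => ρ (n + 1)) (fun n => hρ (n + 1)) s
    refine ⟨fun n => Nat.casesOn n (ρ 0 (t 0)) t, fun n => ?_, hs⟩
    cases n with
    | zero => rfl
    | succ n => exact ht n

theorem conn_mem {n : ℕ} (M : level X (n + 1)) : conn X n M ∈ levelSet M :=
  Vg.root_mem (g := (stage X n).g) M

theorem conn_le {n : ℕ} {M : level X (n + 1)} {x : level X n} (h : x ∈ levelSet M) :
    conn X n M ≤ x := Vg.root_le (g := (stage X n).g) h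

theorem levelSet_anti {n : ℕ} {M N : level X (n + 1)} (h : M ≤ N) : levelSet N ⊆ levelSet M := h

/-- Elements of `z(n+1)` lift to elements of `z(n+2)`. -/
theorem exists_lift (z : Limit X) (n : ℕ) {s : level X n} (hs : s ∈ levelSet (proj (n + 1) z)) :
    ∃ k ∈ levelSet (proj (n + 2) z), conn X n k = s := by
  let M : Vg (stage X n).g := proj (n + 1) z
  let N : Vg (stage X (n + 1)).g := proj (n + 2) z
  have hNM : N.root = M := conn_proj z (n + 1)
  obtain ⟨k, hk, -, he⟩ := N.2.2 N.root N.root_mem (M.restrict s hs)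
    (by rw [hNM]; exact M.le_restrict s hs)
  exact ⟨k, hk, he.trans (Vg.root_restrict M s hs)⟩

theorem exists_above (z : Limit X) (m : ℕ) {s : level X m}
    (hs : s ∈ levelSet (proj (m + 1) z)) : ∃ w, z ≤ w ∧ proj m w = s := by
  let T : ℕ → Type u := fun n => {x : level X n // x ∈ levelSet (proj (n + 1) z)}
  let ρ : ∀ n, T (n + 1) → T n := fun n x => ⟨conn X n x.1, by
    have h1 : proj (n + 1) z ≤ x.1 := by
      rw [← conn_proj]
      exact conn_le x.2
    exact levelSet_anti h1 (conn_mem _)⟩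
  obtain ⟨t, ht, hts⟩ := exists_thread m T ρ (fun n x => by
    obtain ⟨k, hk, he⟩ := exists_lift z n x.2
    exact ⟨⟨k, hk⟩, Subtype.ext he⟩) ⟨s, hs⟩
  refine ⟨⟨fun n => (t n).1, fun n => congrArg Subtype.val (ht n)⟩, fun n => ?_,
    congrArg Subtype.val hts⟩
  change proj n z ≤ (t n).1
  rw [← conn_proj]
  exact conn_le (t n).2

theorem isEsakia : IsEsakia (Limit X) := by
  intro U hU
  refine ⟨isClosed_lowerClosure hU.isClosed, ?_⟩
  rw [isOpen_iff_forall_mem_open]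
  rintro x ⟨y, hy, hxy⟩
  obtain ⟨n, W, hW, hyW, hWU⟩ := mem_nhds (hU.isOpen.mem_nhds hy)
  obtain ⟨W', hW', hyW', hWW'⟩ := exists_clopen_of_closed_subset_open
    (isClosed_singleton (x := proj n y)) hW (singleton_subset_iff.2 hyW)
  refine ⟨proj (n + 1) ⁻¹' lowerClosure (conn X n ⁻¹' W'), ?_,
    ((stage X (n + 1)).isClopen_lower W' hW').isOpen.preimage (proj_continuous _),
    ⟨proj (n + 1) y, ?_, hxy (n + 1)⟩⟩
  · rintro z ⟨M, hM, hzM⟩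
    obtain ⟨w, hzw, hw⟩ := exists_above z n (levelSet_anti hzM (conn_mem M))
    exact ⟨w, hWU (hWW' (show proj n w ∈ W' from hw ▸ hM)), hzw⟩
  · rw [mem_preimage, conn_proj]
    exact hyW' rfl

end Limit

/-- The Esakia space `V_G(X)`. -/
noncomputable def VGobj (X : Pries.{u}) : Esa.{u} := ⟨{ carrier := Limit X }, Limit.isEsakia⟩

/-- The projection `π₀ : V_G(X) → X`. -/
noncomputable def proj₀ (X : Pries.{u}) : Esa.incl.obj (VGobj X) ⟶ X :=
  show ContinuousOrderHom (Limit X) X from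
  ⟨⟨Limit.proj 0, fun _ _ h => h 0⟩, Limit.proj_continuous 0⟩

/-! ### Lifting maps from Esakia spaces -/

section Lift

variable {Z : Type u} [TopologicalSpace Z] [PartialOrder Z] [CompactSpace Z] [PriestleySpace Z]

/-- A map `f : Z → X` is open relative to `g : X → Y`. -/
def IsRelOpen {X Y : Type*} [PartialOrder X] (g : X → Y) (f : Z → X) : Prop :=
  ∀ a b, f a ≤ b → ∃ a', a ≤ a' ∧ g (f a') = g b

theorem isClopen_upper_subset {Z : Type*} [TopologicalSpace Z] [PartialOrder Z]
    (hZ : IsEsakia Z) {A : Set Z} (hA : IsClopen A) :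
    IsClopen {a | Ici a ⊆ A} := by
  have : {a | Ici a ⊆ A} = (lowerClosure Aᶜ : Set Z)ᶜ := by
    ext a
    simp only [mem_ofPred_eq, mem_compl_iff, SetLike.mem_coe, mem_lowerClosure, not_exists,
      not_and]
    exact ⟨fun h x hx hax => hx (h hax), fun h x hax => by_contra fun hx => h x hx hax⟩
  rw [this]
  exact (hZ _ hA.compl).compl

/-- The map `a ↦ f[↑a]` into `V_g(X)`. -/
def liftStep (hZ : IsEsakia Z) (S : Stage.{u}) (f : ContinuousOrderHom Z S.X)
    (hf : IsRelOpen S.g f) : ContinuousOrderHom Z S.VgPries where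
  toFun a := show Vg S.g from ⟨⟨f '' Ici a,
      ((isClosed_principalUp a).isCompact.image f.continuous_toFun).isClosed,
      nonempty_Ici.image f⟩,
    ⟨f a, mem_image_of_mem f self_mem_Ici, by
      rintro _ ⟨b, hb, rfl⟩
      exact f.monotone' hb⟩, by
      rintro _ ⟨b, hb, rfl⟩ c hc
      obtain ⟨b', hbb', he⟩ := hf b c hc
      exact ⟨f b', ⟨b', le_trans (mem_Ici.1 hb) hbb', rfl⟩, f.monotone' hbb', he⟩⟩
  monotone' := fun _ _ hab => image_mono (Ici_subset_Ici.2 hab)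
  continuous_toFun := by
    refine Continuous.subtype_mk ?_ _
    refine continuous_generateFrom_iff.2 ?_
    rintro _ ⟨U, hU, rfl | rfl⟩
    · have h1 : IsClopen {a | Ici a ⊆ f ⁻¹' U} :=
        isClopen_upper_subset hZ (hU.preimage f.continuous_toFun)
      convert h1.isOpen using 1
      ext a
      exact image_subset_iff
    · convert (hZ (f ⁻¹' U) (hU.preimage f.continuous_toFun)).isOpen using 1
      ext a
      constructor
      · rintro ⟨_, ⟨b, hb, rfl⟩, hbU⟩
        exact ⟨b, hbU, hb⟩
      · rintro ⟨b, hbU, hb⟩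
        exact ⟨f b, ⟨b, hb, rfl⟩, hbU⟩

variable {hZ : IsEsakia Z} {S : Stage.{u}} {f : ContinuousOrderHom Z S.X} {hf : IsRelOpen S.g f}

theorem root_liftStep (a : Z) : S.rootMap (liftStep hZ S f hf a) = f a :=
  Vg.root_eq (g := S.g) ⟨mem_image_of_mem f self_mem_Ici, by
    rintro _ ⟨b, hb, rfl⟩
    exact f.monotone' hb⟩

theorem liftStep_relOpen : IsRelOpen S.rootMap (liftStep hZ S f hf) := by
  intro a M hM
  obtain ⟨c, hc, he⟩ : S.rootMap M ∈ f '' Ici a := hM (Vg.root_mem (g := S.g) M)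
  exact ⟨c, hc, (root_liftStep c).trans he⟩

end Lift

section LiftLimit

variable (Z : Esa.{u}) {X : Pries.{u}} (h : Esa.incl.obj Z ⟶ X)

/-- The maps `h_n : Z → V_n(X)`, where `h_0 = h` and `h_{n+1}(a) = h_n[↑a]`. -/
noncomputable def liftSeq : ∀ n, {k : ContinuousOrderHom Z.toPries (level X n) //
    IsRelOpen (stage X n).g k}
  | 0 => ⟨show ContinuousOrderHom Z.toPries X from h, fun a _ _ => ⟨a, le_rfl, rfl⟩⟩
  | n + 1 => ⟨liftStep Z.esakia (stage X n) (liftSeq n).1 (liftSeq n).2, liftStep_relOpen⟩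

theorem conn_liftSeq (n : ℕ) (a : Z.toPries) :
    conn X n ((liftSeq Z h (n + 1)).1 a) = (liftSeq Z h n).1 a :=
  root_liftStep (hZ := Z.esakia) (hf := (liftSeq Z h n).2) a

/-- The unique p-morphism `Z → V_G(X)` lifting `h : Z → X`. -/
noncomputable def lift : Z ⟶ VGobj X :=
  show EsakiaHom Z.toPries (Limit X) from
  { toFun := fun a => ⟨fun n => (liftSeq Z h n).1 a, fun n => conn_liftSeq Z h n a⟩
    monotone' := fun _ _ hab n => (liftSeq Z h n).1.monotone' hab
    continuous_toFun := Continuous.subtype_mk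
      (continuous_pi fun n => (liftSeq Z h n).1.continuous_toFun) _
    exists_map_eq_of_map_le' := by
      intro a y hay
      have hne := IsCompact.nonempty_iInter_of_sequence_nonempty_isCompact_isClosed
        (fun n => Ici a ∩ (liftSeq Z h n).1 ⁻¹' {Limit.proj n y}) ?_ ?_ ?_ ?_
      · obtain ⟨c, hc⟩ := hne
        rw [mem_iInter] at hc
        exact ⟨c, (hc 0).1, Limit.ext_proj fun n => (hc n).2⟩
      · rintro n c ⟨hac, hc⟩
        refine ⟨hac, ?_⟩
        rw [mem_preimage, mem_singleton_iff] at hc ⊢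
        rw [← conn_liftSeq, hc, Limit.conn_proj]
      · intro n
        have h1 : (liftSeq Z h (n + 1)).1 a ≤ Limit.proj (n + 1) y := hay (n + 1)
        have h2 := Limit.levelSet_anti h1 (Limit.conn_mem _)
        rw [Limit.conn_proj] at h2
        obtain ⟨c, hc, he⟩ : Limit.proj n y ∈ (liftSeq Z h n).1 '' Ici a := h2
        exact ⟨c, hc, he⟩
      · exact ((isClosed_principalUp a).inter (isClosed_singleton.preimage
          (liftSeq Z h 0).1.continuous_toFun)).isCompact
      · exact fun n => (isClosed_principalUp a).inter (isClosed_singleton.preimage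
          (liftSeq Z h n).1.continuous_toFun) }

theorem lift_proj₀ : Esa.incl.map (lift Z h) ≫ proj₀ X = h := rfl

theorem lift_unique (k : Z ⟶ VGobj X) (hk : Esa.incl.map k ≫ proj₀ X = h) : k = lift Z h := by
  let k' : EsakiaHom Z.toPries (Limit X) := k
  have key : ∀ n a, Limit.proj n (k' a) = (liftSeq Z h n).1 a := by
    intro n
    induction n with
    | zero =>
      intro a
      subst hk
      rfl
    | succ n ih =>
      intro a
      refine Vg.ext_set (g := (stage X n).g) ?_
      change levelSet (Limit.proj (n + 1) (k' a)) = (liftSeq Z h n).1 '' Ici a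
      ext s
      constructor
      · intro hs
        obtain ⟨w, hw, rfl⟩ := Limit.exists_above _ n hs
        obtain ⟨b, hab, rfl⟩ := k'.exists_map_eq_of_map_le' hw
        exact ⟨b, hab, (ih b).symm⟩
      · rintro ⟨b, hab, rfl⟩
        rw [← ih b, ← Limit.conn_proj (k' b) n]
        have h1 : k' a ≤ k' b := k'.monotone' hab
        exact Limit.levelSet_anti (h1 (n + 1)) (Limit.conn_mem _)
  exact DFunLike.ext (F := EsakiaHom Z.toPries (Limit X)) k' (lift Z h)
    fun a => Limit.ext_proj fun n => key n a

end LiftLimit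

/-! ### The functor `V_G`, the adjunction and the comonad -/

/-- The functor `V_G`; `V_G(p)` is the unique p-morphism over `p ∘ π₀`. -/
noncomputable def VG : Pries.{u} ⥤ Esa.{u} where
  obj X := VGobj X
  map {X _} p := lift (VGobj X) (proj₀ X ≫ p)
  map_id X := (lift_unique _ _ (𝟙 (VGobj X)) rfl).symm
  map_comp {X Y _} p q := (lift_unique _ _
    (lift (VGobj X) (proj₀ X ≫ p) ≫ lift (VGobj Y) (proj₀ Y ≫ q)) rfl).symm

/-- The adjunction between the inclusion of Esakia spaces and `V_G`. The unit is the lift of the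
identity and the counit is `π₀`. -/
noncomputable def adj : Esa.incl.{u} ⊣ VG.{u} :=
  Adjunction.mkOfUnitCounit
    { unit :=
        { app := fun Z => lift Z (𝟙 _)
          naturality := fun Z W f =>
            (lift_unique _ (Esa.incl.map f) _ rfl).trans (lift_unique _ _
              (lift Z (𝟙 _) ≫ lift (VGobj Z.toPries) (proj₀ _ ≫ Esa.incl.map f)) rfl).symm }
      counit :=
        { app := fun X => proj₀ X
          naturality := fun X Y p => rfl }
      left_triangle := rfl
      right_triangle := by
        ext X
        exact (lift_unique (VGobj X) (proj₀ X)
          (lift (VGobj X) (𝟙 _) ≫ lift (VGobj (VGobj X).toPries) (proj₀ _ ≫ proj₀ X)) rfl).trans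
          (lift_unique (VGobj X) (proj₀ X) (𝟙 (VGobj X)) rfl).symm }

/-- The comonad `V_G` on Priestley spaces. -/
noncomputable abbrev VGComonad : Comonad Pries.{u} := adj.{u}.toComonad

/-- `f : X → V_G(X)` is a coalgebra structure for the comonad `V_G`. -/
structure IsCoalgebra {X : Pries.{u}} (f : X ⟶ VGComonad.obj X) : Prop where
  counit : f ≫ VGComonad.ε.app X = 𝟙 X
  coassoc : f ≫ VGComonad.δ.app X = f ≫ VGComonad.map f

end PriestleyDuality

/-!
The whole proof rests on one observation about each of the two coalgebra laws.

*The counit law makes `X` an Esakia space.* If `π₀ ∘ f = 1`, then `X` is a retract in Priestley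
spaces of the Esakia space `V_G(X)`, and for clopen `U` one has `↓U = f⁻¹(↓(π₀⁻¹ U))`
(`IsEsakia.of_retract`).

*Coassociativity makes `f` a p-morphism.* If `f` and `g` are sections of `π₀` and
`V_G(p) ∘ f = g ∘ p`, then `p x ≤ y` gives `V_G(p)(f x) ≤ g y`. Since `V_G(p)` is a p-morphism there
is `w ≥ f x` with `V_G(p)(w) = g y`, and `π₀ w ≥ x` is mapped to `y` by `p`
(`isPMorphism_of_comp_eq`). Coassociativity of `f` is the case `p = f`, `g = η`. By the universal
property of `V_G(X)`, the unit is then the only coalgebra structure on an Esakia space, and on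
Esakia spaces coalgebra morphisms and p-morphisms agree. Thus the comparison functor is full and
essentially surjective; it is faithful because the inclusion is. The characterisations by `x ↦ ↑x`
and `C ↦ ↑C` hold since the preimages of `⟨U⟩` under these maps are `↓U` and `⟨↓U⟩`.

The same observations, read algebraically, prove that Heyting algebras are monadic over bounded
distributive lattices. The left adjoint is the free Heyting algebra `FreeHeyting L`, formed by terms
modulo the derivable inequalities. An algebra `α : FreeHeyting A → A` exhibits `A` as a retract, so
`a ⇨ b := α (of a ⇨ of b)` is a Heyting implication on `A` (`FreeHeyting.heytingAlgebra`), and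
associativity, evaluated at `of x ⇨ of y`, says that `α` preserves implication
(`FreeHeyting.str_himp`).
-/

namespace PriestleyDuality

/-! ### The Esakia condition and the maps `x ↦ ↑x` and `C ↦ ↑C` -/

theorem Vietoris.continuous_of_isClopen_dia {X Z : Type*} [TopologicalSpace X]
    [TopologicalSpace Z] {f : Z → Vietoris X}
    (h : ∀ U : Set X, IsClopen U → IsClopen (f ⁻¹' dia U)) : Continuous f := by
  refine continuous_generateFrom_iff.2 ?_
  rintro _ ⟨U, hU, rfl | rfl⟩
  · have hc := (h _ hU.compl).compl.isOpen
    rwa [← preimage_compl, compl_dia, compl_compl] at hc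
  · exact (h U hU).isOpen

section UpMaps

variable {X : Type*} [TopologicalSpace X] [PartialOrder X] [CompactSpace X] [PriestleySpace X]

theorem monotone_upPoint : Monotone (upPoint (X := X)) := fun _ _ h => Ici_subset_Ici.2 h

theorem monotone_upSet : Monotone (upSet (X := X)) := fun C D h => by
  rintro x ⟨y, hy, hyx⟩
  exact ⟨y, h hy, hyx⟩

theorem upPoint_preimage_dia (U : Set X) :
    upPoint ⁻¹' Vietoris.dia U = (lowerClosure U : Set X) := by
  ext x
  exact ⟨fun ⟨y, hxy, hy⟩ => ⟨y, hy, hxy⟩, fun ⟨y, hy, hxy⟩ => ⟨y, hxy, hy⟩⟩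

theorem upSet_preimage_dia (U : Set X) :
    upSet ⁻¹' Vietoris.dia U = Vietoris.dia (lowerClosure U : Set X) := by
  ext C
  constructor
  · rintro ⟨y, ⟨x, hx, hxy⟩, hy⟩
    exact ⟨x, hx, y, hy, hxy⟩
  · rintro ⟨x, hx, y, hy, hxy⟩
    exact ⟨y, ⟨x, hx, hxy⟩, hy⟩

theorem isEsakia_iff_continuous_upPoint : IsEsakia X ↔ Continuous (upPoint (X := X)) := by
  refine ⟨fun h => Vietoris.continuous_of_isClopen_dia fun U hU => ?_, fun h U hU => ?_⟩
  · rw [upPoint_preimage_dia]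
    exact h U hU
  · rw [← upPoint_preimage_dia]
    exact (Vietoris.isClopen_dia hU).preimage h

theorem isEsakia_iff_continuous_upSet : IsEsakia X ↔ Continuous (upSet (X := X)) := by
  refine ⟨fun h => Vietoris.continuous_of_isClopen_dia fun U hU => ?_, fun h => ?_⟩
  · rw [upSet_preimage_dia]
    exact Vietoris.isClopen_dia (h U hU)
  · -- `x ↦ ↑x` is the composite of `x ↦ {x}` with `C ↦ ↑C`.
    let sing (x : X) : Vietoris X := ⟨{x}, isClosed_singleton, singleton_nonempty x⟩
    have hs : Continuous sing := Vietoris.continuous_of_isClopen_dia fun U hU => by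
      convert hU using 1
      ext x
      exact singleton_inter_nonempty
    have hup : (upPoint : X → Vietoris X) = upSet ∘ sing := by
      funext x
      refine Subtype.ext ?_
      change Ici x = (upperClosure {x} : Set X)
      rw [upperClosure_singleton, UpperSet.coe_Ici]
    rw [isEsakia_iff_continuous_upPoint, hup]
    exact h.comp hs

end UpMaps

/-- For `i : X → Z` and `r : Z → X` with `r ∘ i = 1` one has `↓U = i⁻¹(↓(r⁻¹ U))`. -/
theorem IsEsakia.of_retract {X Z : Type*} [TopologicalSpace X] [PartialOrder X]
    [TopologicalSpace Z] [PartialOrder Z] (hZ : IsEsakia Z) {i : X → Z} {r : Z → X}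
    (hi : Continuous i) (hr : Continuous r) (hi' : Monotone i) (hr' : Monotone r)
    (h : Function.LeftInverse r i) : IsEsakia X := by
  intro U hU
  convert (hZ _ (hU.preimage hr)).preimage hi using 1
  ext x
  constructor
  · rintro ⟨y, hy, hxy⟩
    exact ⟨i y, by rwa [mem_preimage, h y], hi' hxy⟩
  · rintro ⟨z, hz, hxz⟩
    exact ⟨r z, hz, by simpa only [h x] using hr' hxz⟩

/-! ### Coalgebras for the comonad `V_G` -/

section Coalgebra

variable {X Y : Pries.{u}}

theorem IsCoalgebra.proj₀_apply {f : X ⟶ VGComonad.obj X} (hf : IsCoalgebra f) (x : X) :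
    proj₀ X (f x) = x :=
  DFunLike.congr_fun (F := ContinuousOrderHom X X) hf.counit x

theorem IsCoalgebra.isEsakia {f : X ⟶ VGComonad.obj X} (hf : IsCoalgebra f) : IsEsakia X :=
  (VGobj X).esakia.of_retract (ContinuousOrderHom.continuous_toFun f)
    (ContinuousOrderHom.continuous_toFun (proj₀ X)) f.monotone' (proj₀ X).monotone'
    hf.proj₀_apply

/-- A Priestley map `p` which commutes with sections of `π₀` is a p-morphism: the back condition is
transported from `V_G(p)`. Coassociativity of the sections is not needed. -/
theorem isPMorphism_of_comp_eq {f : X ⟶ VGComonad.obj X} {g : Y ⟶ VGComonad.obj Y} {p : X ⟶ Y}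
    (hf : ∀ x, proj₀ X (f x) = x) (hg : ∀ y, proj₀ Y (g y) = y)
    (h : f ≫ VGComonad.map p = p ≫ g) : IsPMorphism p := by
  intro x y hxy
  let Vp : EsakiaHom (Limit X) (Limit Y) := VG.map p
  have h1 : Vp (f x) = g (p x) :=
    DFunLike.congr_fun (F := ContinuousOrderHom X (Limit Y)) h x
  have h2 : Vp (f x) ≤ g y := h1.trans_le (g.monotone' hxy)
  obtain ⟨w, hw, hwy⟩ := Vp.exists_map_eq_of_map_le' h2
  refine ⟨proj₀ X w, ?_, ?_⟩
  · have := (proj₀ X).monotone' hw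
    rwa [← hf x]
  · rw [← hg y]
    exact congrArg (proj₀ Y) hwy

/-- By coassociativity, `f` is a morphism from the coalgebra `f` to the cofree coalgebra
`η_{V_G(X)}`. -/
theorem IsCoalgebra.isPMorphism {f : X ⟶ VGComonad.obj X} (hf : IsCoalgebra f) :
    IsPMorphism f :=
  isPMorphism_of_comp_eq (f := f) (g := VGComonad.δ.app X) hf.proj₀_apply (fun _ => rfl)
    hf.coassoc.symm

/-- A p-morphism between Esakia spaces as a morphism of `Esa`. -/
def Esa.homMk {Z W : Esa.{u}} (p : Z.toPries ⟶ W.toPries) (hp : IsPMorphism p) : Z ⟶ W :=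
  show EsakiaHom Z.toPries W.toPries from
  { toContinuousOrderHom := p
    exists_map_eq_of_map_le' := hp }

/-- The unit `X → V_G(X)` at an Esakia space `X`, as a Priestley map. -/
noncomputable def etaMap (hX : IsEsakia X) : X ⟶ VGComonad.obj X :=
  Esa.incl.map (adj.unit.app ⟨X, hX⟩)

theorem isCoalgebra_etaMap (hX : IsEsakia X) : IsCoalgebra (etaMap hX) where
  counit := ((Comonad.comparison adj).obj ⟨X, hX⟩).counit
  coassoc := ((Comonad.comparison adj).obj ⟨X, hX⟩).coassoc

theorem IsCoalgebra.eq_etaMap {f : X ⟶ VGComonad.obj X} (hf : IsCoalgebra f) :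
    f = etaMap hf.isEsakia :=
  congrArg Esa.incl.map
    (lift_unique ⟨X, hf.isEsakia⟩ (𝟙 X) (Esa.homMk (W := VGobj X) f hf.isPMorphism) hf.counit)

theorem comp_map_eq_iff_isPMorphism {f : X ⟶ VGComonad.obj X} {g : Y ⟶ VGComonad.obj Y}
    (hf : IsCoalgebra f) (hg : IsCoalgebra g) (p : X ⟶ Y) :
    f ≫ VGComonad.map p = p ≫ g ↔ IsPMorphism p := by
  refine ⟨isPMorphism_of_comp_eq hf.proj₀_apply hg.proj₀_apply, fun hp => ?_⟩
  rw [hf.eq_etaMap, hg.eq_etaMap]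
  exact congrArg Esa.incl.map (adj.unit.naturality
    (Esa.homMk (Z := ⟨X, hf.isEsakia⟩) (W := ⟨Y, hg.isEsakia⟩) p hp)).symm

theorem isEsakia_tfae (X : Pries.{u}) : List.TFAE
    [IsEsakia X, ∃ f : X ⟶ VGComonad.obj X, IsCoalgebra f,
      ∃! f : X ⟶ VGComonad.obj X, IsCoalgebra f,
      Monotone (upPoint (X := X)) ∧ Continuous (upPoint (X := X)),
      Monotone (upSet (X := X)) ∧ Continuous (upSet (X := X))] := by
  tfae_have 1 → 3 := fun h => ⟨etaMap h, isCoalgebra_etaMap h, fun _ hf => hf.eq_etaMap⟩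
  tfae_have 3 → 2 := fun h => h.exists
  tfae_have 2 → 1 := fun ⟨_, hf⟩ => hf.isEsakia
  tfae_have 1 ↔ 4 := by simp [isEsakia_iff_continuous_upPoint, monotone_upPoint]
  tfae_have 1 ↔ 5 := by simp [isEsakia_iff_continuous_upSet, monotone_upSet]
  tfae_finish

theorem isCoalgebra_coalgebra (C : VGComonad.{u}.Coalgebra) : IsCoalgebra C.a :=
  ⟨C.counit, C.coassoc⟩

instance : Esa.incl.{u}.Faithful where
  map_injective {Z W} _ _ h :=
    DFunLike.ext (F := EsakiaHom Z.toPries W.toPries) _ _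
      (DFunLike.congr_fun (F := ContinuousOrderHom Z.toPries W.toPries) h)

instance : (Comonad.comparison adj.{u}).Full where
  map_surjective φ :=
    ⟨Esa.homMk φ.f ((comp_map_eq_iff_isPMorphism (isCoalgebra_coalgebra _)
      (isCoalgebra_coalgebra _) φ.f).1 φ.h), rfl⟩

instance : (Comonad.comparison adj.{u}).EssSurj where
  mem_essImage C :=
    have hC := isCoalgebra_coalgebra C
    ⟨⟨C.A, hC.isEsakia⟩, ⟨Comonad.Coalgebra.isoMk (Iso.refl C.A) (by
      change etaMap hC.isEsakia ≫ VGComonad.map (𝟙 C.A) = 𝟙 C.A ≫ C.a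
      rw [← hC.eq_etaMap, CategoryTheory.Functor.map_id, Category.id_comp]
      exact Category.comp_id _)⟩⟩

end Coalgebra

end PriestleyDuality

/-! ### The free Heyting algebra on a bounded distributive lattice -/

namespace FreeHeyting

/-- Terms in the language of Heyting algebras with generators from `L`. -/
inductive Term (L : Type u) : Type u
  | of (a : L) : Term L
  | top : Term L
  | bot : Term L
  | inf (s t : Term L) : Term L
  | sup (s t : Term L) : Term L
  | imp (s t : Term L) : Term L

variable (L : Type u) [DistribLattice L] [BoundedOrder L]

/-- The least preorder on terms which satisfies the laws of a Heyting algebra and makes `Term.of`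
a homomorphism of bounded lattices. That `of` is monotone follows from `of_inf_le_right`, since
`a ≤ b` means `a ⊓ b = a`. -/
inductive Le : Term L → Term L → Prop
  | refl (s) : Le s s
  | trans {s t r} : Le s t → Le t r → Le s r
  | le_top (s) : Le s .top
  | bot_le (s) : Le .bot s
  | inf_le_left (s t) : Le (.inf s t) s
  | inf_le_right (s t) : Le (.inf s t) t
  | le_inf {s t r} : Le s t → Le s r → Le s (.inf t r)
  | le_sup_left (s t) : Le s (.sup s t)
  | le_sup_right (s t) : Le t (.sup s t)
  | sup_le {s t r} : Le s r → Le t r → Le (.sup s t) r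
  | le_imp {s t r} : Le (.inf s t) r → Le s (.imp t r)
  | imp_le {s t r} : Le s (.imp t r) → Le (.inf s t) r
  | of_top : Le .top (.of ⊤)
  | of_bot : Le (.of ⊥) .bot
  | of_inf (a b) : Le (.inf (.of a) (.of b)) (.of (a ⊓ b))
  | of_inf_le_left (a b) : Le (.of (a ⊓ b)) (.of a)
  | of_inf_le_right (a b) : Le (.of (a ⊓ b)) (.of b)
  | of_sup (a b) : Le (.of (a ⊔ b)) (.sup (.of a) (.of b))

instance : Preorder (Term L) where
  le := Le L
  le_refl := Le.refl
  le_trans _ _ _ := Le.trans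

end FreeHeyting

open FreeHeyting in
/-- The free Heyting algebra on the bounded distributive lattice `L`. -/
def FreeHeyting (L : Type u) [DistribLattice L] [BoundedOrder L] : Type u :=
  Antisymmetrization (Term L) (· ≤ ·)

namespace FreeHeyting

variable {L : Type u} [DistribLattice L] [BoundedOrder L]

instance : PartialOrder (FreeHeyting L) :=
  inferInstanceAs (PartialOrder (Antisymmetrization (Term L) (· ≤ ·)))

/-- The class of a term. -/
def mk (t : Term L) : FreeHeyting L := toAntisymmetrization (· ≤ ·) t

theorem mk_le_mk {s t : Term L} : mk s ≤ mk t ↔ Le L s t := Iff.rfl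

@[elab_as_elim]
theorem ind {p : FreeHeyting L → Prop} (h : ∀ t, p (mk t)) (x : FreeHeyting L) : p x :=
  Quotient.inductionOn' x h

/-- A binary operation on terms which is compatible with the equivalence of terms, as an operation
on classes. -/
def map₂ (op : Term L → Term L → Term L)
    (h : ∀ {s s' t t'}, AntisymmRel (Le L) s s' → AntisymmRel (Le L) t t' →
      Le L (op s t) (op s' t')) : FreeHeyting L → FreeHeyting L → FreeHeyting L :=
  Quotient.map₂ op fun _ _ hs _ _ ht => ⟨h hs ht, h hs.symm ht.symm⟩

instance : HeytingAlgebra (FreeHeyting L) where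
  sup := map₂ .sup fun hs ht =>
    .sup_le (hs.1.trans (.le_sup_left _ _)) (ht.1.trans (.le_sup_right _ _))
  inf := map₂ .inf fun hs ht =>
    .le_inf (.trans (.inf_le_left _ _) hs.1) (.trans (.inf_le_right _ _) ht.1)
  himp := map₂ .imp fun hs ht => .le_imp (.trans
    (.le_inf (.inf_le_left _ _) (.trans (.inf_le_right _ _) hs.2)) (.trans (.imp_le (.refl _)) ht.1))
  top := mk .top
  bot := mk .bot
  compl := fun x => map₂ .imp (fun hs ht => .le_imp (.trans
    (.le_inf (.inf_le_left _ _) (.trans (.inf_le_right _ _) hs.2))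
      (.trans (.imp_le (.refl _)) ht.1))) x (mk .bot)
  le_top := ind fun _ => mk_le_mk.2 (.le_top _)
  bot_le := ind fun _ => mk_le_mk.2 (.bot_le _)
  le_sup_left := ind fun _ => ind fun _ => mk_le_mk.2 (.le_sup_left _ _)
  le_sup_right := ind fun _ => ind fun _ => mk_le_mk.2 (.le_sup_right _ _)
  sup_le := ind fun _ => ind fun _ => ind fun _ h k =>
    mk_le_mk.2 (.sup_le (mk_le_mk.1 h) (mk_le_mk.1 k))
  inf_le_left := ind fun _ => ind fun _ => mk_le_mk.2 (.inf_le_left _ _)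
  inf_le_right := ind fun _ => ind fun _ => mk_le_mk.2 (.inf_le_right _ _)
  le_inf := ind fun _ => ind fun _ => ind fun _ h k =>
    mk_le_mk.2 (.le_inf (mk_le_mk.1 h) (mk_le_mk.1 k))
  le_himp_iff := ind fun _ => ind fun _ => ind fun _ =>
    ⟨fun h => mk_le_mk.2 (.imp_le (mk_le_mk.1 h)), fun h => mk_le_mk.2 (.le_imp (mk_le_mk.1 h))⟩
  himp_bot _ := rfl

/-- The inclusion of the generators. -/
def of : BoundedLatticeHom L (FreeHeyting L) where
  toFun a := mk (.of a)
  map_sup' a b := by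
    have mono : ∀ {a b : L}, a ≤ b → mk (.of a) ≤ mk (.of b) := fun {a b} h => by
      have := mk_le_mk.2 (Le.of_inf_le_right a b)
      rwa [inf_eq_left.2 h] at this
    exact le_antisymm (mk_le_mk.2 (.of_sup a b)) (sup_le (mono le_sup_left) (mono le_sup_right))
  map_inf' a b := le_antisymm
    (mk_le_mk.2 (.le_inf (.of_inf_le_left a b) (.of_inf_le_right a b)))
    (mk_le_mk.2 (.of_inf a b))
  map_top' := le_antisymm le_top (mk_le_mk.2 .of_top)
  map_bot' := le_antisymm (mk_le_mk.2 .of_bot) bot_le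

variable {H : Type*} [HeytingAlgebra H]

/-- The value of a term under an interpretation of the generators. -/
def eval (f : L → H) : Term L → H
  | .of a => f a
  | .top => ⊤
  | .bot => ⊥
  | .inf s t => eval f s ⊓ eval f t
  | .sup s t => eval f s ⊔ eval f t
  | .imp s t => eval f s ⇨ eval f t

theorem eval_mono (f : BoundedLatticeHom L H) {s t : Term L} (h : Le L s t) :
    eval f s ≤ eval f t := by
  induction h with
  | refl => exact le_rfl
  | trans _ _ h k => exact h.trans k
  | le_top => exact le_top
  | bot_le => exact bot_le
  | inf_le_left => exact inf_le_left
  | inf_le_right => exact inf_le_right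
  | le_inf _ _ h k => exact le_inf h k
  | le_sup_left => exact le_sup_left
  | le_sup_right => exact le_sup_right
  | sup_le _ _ h k => exact sup_le h k
  | le_imp _ h => exact le_himp_iff.2 h
  | imp_le _ h => exact le_himp_iff.1 h
  | of_top => exact (map_top f).ge
  | of_bot => exact (map_bot f).le
  | of_inf a b => exact (map_inf f a b).ge
  | of_inf_le_left => exact OrderHomClass.mono f inf_le_left
  | of_inf_le_right => exact OrderHomClass.mono f inf_le_right
  | of_sup a b => exact (map_sup f a b).le

/-- The extension of a homomorphism of bounded lattices to the free Heyting algebra. -/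
def extend (f : BoundedLatticeHom L H) : HeytingHom (FreeHeyting L) H where
  toFun := Quotient.lift (eval f) fun _ _ h => (eval_mono f h.1).antisymm (eval_mono f h.2)
  map_sup' := ind fun _ => ind fun _ => rfl
  map_inf' := ind fun _ => ind fun _ => rfl
  map_bot' := rfl
  map_himp' := ind fun _ => ind fun _ => rfl

theorem hom_ext {f g : HeytingHom (FreeHeyting L) H} (h : ∀ a, f (of a) = g (of a)) : f = g := by
  refine DFunLike.ext _ _ (ind fun t => ?_)
  induction t with
  | of a => exact h a
  | top => exact (map_top f).trans (map_top g).symm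
  | bot => exact (map_bot f).trans (map_bot g).symm
  | inf s t hs ht =>
    exact (map_inf f (mk s) (mk t)).trans (by rw [hs, ht]; exact (map_inf g (mk s) (mk t)).symm)
  | sup s t hs ht =>
    exact (map_sup f (mk s) (mk t)).trans (by rw [hs, ht]; exact (map_sup g (mk s) (mk t)).symm)
  | imp s t hs ht =>
    exact (map_himp f (mk s) (mk t)).trans (by rw [hs, ht]; exact (map_himp g (mk s) (mk t)).symm)

/-- Homomorphisms out of the free Heyting algebra. -/
def homEquiv (L : BddDistLat.{u}) (H : HeytAlg.{u}) :
    (HeytAlg.of (FreeHeyting L) ⟶ H) ≃ (L ⟶ (forget₂ HeytAlg BddDistLat).obj H) where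
  toFun f := BddDistLat.ofHom (((forget₂ HeytAlg BddDistLat).map f).hom.comp of)
  invFun f := HeytAlg.ofHom (extend (H := H) f.hom)
  left_inv _ := HeytAlg.hom_ext (hom_ext fun _ => rfl)
  right_inv _ := rfl

/-- The free Heyting algebra functor. -/
def functor : BddDistLat.{u} ⥤ HeytAlg.{u} :=
  Adjunction.leftAdjointOfEquiv homEquiv fun _ _ _ _ _ => rfl

/-- The adjunction between the free Heyting algebra functor and the forgetful functor. -/
def adjunction : functor ⊣ forget₂ HeytAlg.{u} BddDistLat.{u} :=
  Adjunction.adjunctionOfEquivLeft homEquiv fun _ _ _ _ _ => rfl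

end FreeHeyting

/-! ### Algebras for the free Heyting algebra monad -/

namespace FreeHeyting

/-- The monad of free Heyting algebras on bounded distributive lattices. -/
abbrev monad : Monad BddDistLat.{u} := adjunction.{u}.toMonad

variable (A : monad.{u}.Algebra)

/-- The structure map of an algebra, as a homomorphism of bounded lattices. -/
def str : BoundedLatticeHom (FreeHeyting A.A) A.A :=
  BddDistLat.Hom.hom A.a

theorem str_of (a : A.A) : str A (of a) = a :=
  congrArg (fun f : A.A ⟶ A.A => f a) A.unit

/-- The Heyting algebra which underlies an algebra `A` of the monad: since `A` is a retract of the
Heyting algebra `FreeHeyting A`, it has the implication `a ⇨ b`, the image of `of a ⇨ of b`. -/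
abbrev heytingAlgebra : HeytingAlgebra A.A :=
  { (inferInstance : DistribLattice A.A), (inferInstance : BoundedOrder A.A) with
    himp := fun a b => str A (of a ⇨ of b)
    compl := fun a => str A (of a ⇨ of ⊥)
    le_himp_iff := fun a b c => by
      constructor
      · intro h
        calc a ⊓ b ≤ str A (of b ⇨ of c) ⊓ str A (of b) := by
              rw [str_of A b]
              exact inf_le_inf_right b h
          _ = str A ((of b ⇨ of c) ⊓ of b) := (map_inf (str A) _ _).symm
          _ ≤ str A (of c) := OrderHomClass.mono (str A) himp_inf_le
          _ = c := str_of A c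
      · intro h
        rw [← str_of A a]
        refine OrderHomClass.mono (str A) (le_himp_iff.2 ?_)
        rw [← map_inf]
        exact OrderHomClass.mono of h
    himp_bot := fun _ => rfl }

/-- By associativity, the structure map sends `x ⇨ y = ε (of x ⇨ of y)` to the value of
`of (str A x) ⇨ of (str A y)`, which is the implication of `str A x` and `str A y` in `A`. -/
theorem str_himp (x y : FreeHeyting A.A) :
    str A (x ⇨ y) = str A (of (str A x) ⇨ of (str A y)) :=
  ConcreteCategory.congr_hom A.assoc (of x ⇨ of y : FreeHeyting (FreeHeyting A.A))

/-- The structure map as a homomorphism of Heyting algebras. -/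
def strHom : letI := heytingAlgebra A; HeytingHom (FreeHeyting A.A) A.A :=
  letI := heytingAlgebra A
  { (str A).toLatticeHom with
    map_bot' := map_bot (str A)
    map_himp' := str_himp A }

/-- A morphism `φ` of algebras between Heyting algebras preserves `x ⇨ y`, because this is the value
of `of x ⇨ of y` under the structure map. -/
instance : (Monad.comparison adjunction.{u}).Full where
  map_surjective {H K} φ := by
    let f : BoundedLatticeHom H K := BddDistLat.Hom.hom φ.f
    have hf (x y : H) : f (x ⇨ y) = f x ⇨ f y :=
      (ConcreteCategory.congr_hom φ.h (of x ⇨ of y : FreeHeyting H)).symm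
    exact ⟨HeytAlg.ofHom { f.toLatticeHom with map_bot' := map_bot f, map_himp' := hf }, rfl⟩

instance : (Monad.comparison adjunction.{u}).EssSurj where
  mem_essImage A := by
    let := heytingAlgebra A
    have hstr : extend (BoundedLatticeHom.id A.A) = strHom A :=
      hom_ext fun a => (str_of A a).symm
    have ha : ((Monad.comparison adjunction).obj (HeytAlg.of A.A)).a = A.a :=
      BddDistLat.ext fun x => DFunLike.congr_fun hstr x
    exact ⟨HeytAlg.of A.A, ⟨Monad.Algebra.isoMk (Iso.refl A.A) (by
      change monad.map (𝟙 A.A) ≫ A.a = _ ≫ 𝟙 A.A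
      rw [ha, CategoryTheory.Functor.map_id]
      rfl)⟩⟩

instance : (Monad.comparison adjunction.{u}).IsEquivalence where

end FreeHeyting

theorem mainTheorem3 :
    (∀ X : PriestleyDuality.Pries.{u}, List.TFAE
      [PriestleyDuality.IsEsakia X,
        ∃ f : X ⟶ PriestleyDuality.VGComonad.obj X, PriestleyDuality.IsCoalgebra f,
        ∃! f : X ⟶ PriestleyDuality.VGComonad.obj X, PriestleyDuality.IsCoalgebra f,
        Monotone (PriestleyDuality.upPoint (X := X)) ∧
          Continuous (PriestleyDuality.upPoint (X := X)),
        Monotone (PriestleyDuality.upSet (X := X)) ∧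
          Continuous (PriestleyDuality.upSet (X := X))]) ∧
    (∀ (X Y : PriestleyDuality.Pries.{u})
      (f : X ⟶ PriestleyDuality.VGComonad.obj X) (g : Y ⟶ PriestleyDuality.VGComonad.obj Y),
      PriestleyDuality.IsCoalgebra f → PriestleyDuality.IsCoalgebra g → ∀ p : X ⟶ Y,
        f ≫ PriestleyDuality.VGComonad.map p = p ≫ g ↔ PriestleyDuality.IsPMorphism p) ∧
    (Comonad.comparison PriestleyDuality.adj.{u}).IsEquivalence ∧
    Nonempty (MonadicRightAdjoint (forget₂ HeytAlg.{u} BddDistLat.{u})) := by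
  exact ⟨PriestleyDuality.isEsakia_tfae,
    fun _ _ _ _ hf hg p => PriestleyDuality.comp_map_eq_iff_isPMorphism hf hg p, {},
    ⟨{ L := FreeHeyting.functor, adj := FreeHeyting.adjunction, eqv := inferInstance }⟩⟩
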